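/- Let $(M,g)$ and $(B,g_B)$ be smooth Riemannian manifolds, and let $J$ be a smooth integrable almost complex structure on $M$ with $g(JX,JY)=g(X,Y)$. Put $\Omega(X,Y)=g(X,JY)$ and suppose that $(M,J,g)$ is locally conformal Kähler with Lee form $\omega$, that is, $\omega$ is a closed $1$-form on $M$ with $d\Omega=\omega\wedge\Omega$. Let $B_1=\omega^\sharp$ be the Lee vector field, so $g(X,B_1)=\omega(X)$. Let $\pi:M\to B$ be a Lagrangian Riemannian submersion: a smooth surjective map whose differential $\pi_*$ is surjective at every point and preserves the lengths of horizontal vectors, i.e. of vectors in $(\ker\pi_*)^\perp$, and such that $J(\ker\pi_*)=(\ker\pi_*)^\perp$. Let $\nabla$ be the Levi-Civita connection of $g$, let $\mathcal H,\mathcal V$ be the orthogonal projections onto $(\ker\pi_*)^\perp$ and $\ker\pi_*$, let $\mathcal A_EF=\mathcal H\nabla_{\mathcal HE}\mathcal VF+\mathcal V\nabla_{\mathcal HE}\mathcal HF$ be O'Neill's tensor, and let $(\nabla\pi_*)(X,Y)=\nabla^\pi_X\pi_*Y-\pi_*(\nabla_XY)$ be the second fundamental form of $\pi$, where $\nabla^\pi$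 is the pullback to $\pi^{-1}(TB)$ of the Levi-Civita connection of $g_B$. Then the following are equivalent: (a) $(\ker\pi_*)^\perp$ defines a totally geodesic foliation on $M$, i.e. for all smooth sections $X,Y$ of $(\ker\pi_*)^\perp$, both $[X,Y]$ and $\nabla_XY$ are sections of $(\ker\pi_*)^\perp$; (b) $g_B(\pi_*(\mathcal A_XJY),\pi_*JV)=\tfrac12\,g(JY,B_1)\,g(X,JV)+\tfrac12\,g(X,Y)\,g(B_1,V)$ for all smooth sections $X,Y$ of $(\ker\pi_*)^\perp$ and $V$ of $\ker\pi_*$; (c) $g_B((\nabla\pi_*)(X,JY),\pi_*JV)=-\tfrac12\,g(JY,B_1)\,g(X,JV)-\tfrac12\,g(X,Y)\,g(B_1,V)$ for all smooth sections $X,Y$ of $(\ker\pi_*)^\perp$ and $V$ of $\ker\pi_*$. -/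

import Mathlib

open Bundle Manifold VectorField
open scoped ContDiff

noncomputable section

namespace LagrangianSubmersion

section OneManifold

variable {E : Type*} [NormedAddCommGroup E] [NormedSpace ℝ E]
  {H : Type*} [TopologicalSpace H] (I : ModelWithCorners ℝ E H)
  {M : Type*} [TopologicalSpace M] [ChartedSpace H M] [IsManifold I ∞ M]

/-- `X` is a smooth (`C^∞`) vector field on `M`. -/
def IsSmoothField (X : Π p : M, TangentSpace I p) : Prop :=
  ContMDiff I I.tangent ∞ (fun p ↦ (⟨p, X p⟩ : TangentBundle I M))

/-- `η` is a smooth `1`-form on `M`. -/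
def IsSmoothOneForm (η : Π p : M, TangentSpace I p →L[ℝ] ℝ) : Prop :=
  ContMDiff I (I.prod 𝓘(ℝ, E →L[ℝ] ℝ)) ∞
    (fun p ↦ TotalSpace.mk' (E →L[ℝ] ℝ)
      (E := fun q : M ↦ TangentSpace I q →L[ℝ] Bundle.Trivial M ℝ q) p (η p))

/-- `J` is a smooth field of endomorphisms of the tangent spaces of `M`. -/
def IsSmoothEndo (J : Π p : M, TangentSpace I p →L[ℝ] TangentSpace I p) : Prop :=
  ContMDiff I (I.prod 𝓘(ℝ, E →L[ℝ] E)) ∞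
    (fun p ↦ TotalSpace.mk' (E →L[ℝ] E)
      (E := fun q : M ↦ TangentSpace I q →L[ℝ] TangentSpace I q) p (J p))

/-- `X` is a section of the distribution `D`. -/
def IsSectionOf (D : Π p : M, Submodule ℝ (TangentSpace I p))
    (X : Π p : M, TangentSpace I p) : Prop :=
  ∀ p, X p ∈ D p

/-- The exterior derivative of a `1`-form on vector fields:
`dη(X, Y) = X(η(Y)) - Y(η(X)) - η([X, Y])`. -/
def extDerivOne (η : Π p : M, TangentSpace I p →L[ℝ] ℝ)
    (X Y : Π p : M, TangentSpace I p) (p : M) : ℝ :=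
  mvfderiv I (fun q ↦ η q (Y q)) p (X p) - mvfderiv I (fun q ↦ η q (X q)) p (Y p)
    - η p (mlieBracket I X Y p)

/-- The exterior derivative of a `2`-form on vector fields:
`dΩ(X, Y, Z) = XΩ(Y, Z) + YΩ(Z, X) + ZΩ(X, Y) - Ω([X, Y], Z) - Ω([Y, Z], X) - Ω([Z, X], Y)`. -/
def extDerivTwo (Ω : Π p : M, TangentSpace I p → TangentSpace I p → ℝ)
    (X Y Z : Π p : M, TangentSpace I p) (p : M) : ℝ :=
  mvfderiv I (fun q ↦ Ω q (Y q) (Z q)) p (X p)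
    + mvfderiv I (fun q ↦ Ω q (Z q) (X q)) p (Y p)
    + mvfderiv I (fun q ↦ Ω q (X q) (Y q)) p (Z p)
    - Ω p (mlieBracket I X Y p) (Z p)
    - Ω p (mlieBracket I Y Z p) (X p)
    - Ω p (mlieBracket I Z X p) (Y p)

/-- The wedge product of a `1`-form and a `2`-form:
`(η ∧ Ω)(X, Y, Z) = η(X)Ω(Y, Z) + η(Y)Ω(Z, X) + η(Z)Ω(X, Y)`. -/
def wedgeOneTwo (η : Π p : M, TangentSpace I p →L[ℝ] ℝ)
    (Ω : Π p : M, TangentSpace I p → TangentSpace I p → ℝ)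
    (X Y Z : Π p : M, TangentSpace I p) (p : M) : ℝ :=
  η p (X p) * Ω p (Y p) (Z p) + η p (Y p) * Ω p (Z p) (X p) + η p (Z p) * Ω p (X p) (Y p)

/-- The Nijenhuis tensor `N(X, Y) = [JX, JY] - J[JX, Y] - J[X, JY] - [X, Y]` of an almost complex
structure `J`. -/
def nijenhuis (J : Π p : M, TangentSpace I p →L[ℝ] TangentSpace I p)
    (X Y : Π p : M, TangentSpace I p) (p : M) : TangentSpace I p :=
  mlieBracket I (fun q ↦ J q (X q)) (fun q ↦ J q (Y q)) p
    - J p (mlieBracket I (fun q ↦ J q (X q)) Y p)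
    - J p (mlieBracket I X (fun q ↦ J q (Y q)) p)
    - mlieBracket I X Y p

variable [FiniteDimensional ℝ E]

instance finiteDimensional_tangentSpace (p : M) : FiniteDimensional ℝ (TangentSpace I p) :=
  inferInstanceAs (FiniteDimensional ℝ E)

variable [RiemannianBundle (fun p : M ↦ TangentSpace I p)]

instance completeSpace_tangentSpace (p : M) : CompleteSpace (TangentSpace I p) :=
  FiniteDimensional.complete ℝ (TangentSpace I p)

/-- The right-hand side of the Koszul formula, i.e. `2 g(∇_X Y, Z)` at `p`, where `∇` is the
Levi-Civita connection of the Riemannian metric `g`. -/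
def koszul (X Y Z : Π p : M, TangentSpace I p) (p : M) : ℝ :=
  mvfderiv I (fun q ↦ inner ℝ (Y q) (Z q)) p (X p)
    + mvfderiv I (fun q ↦ inner ℝ (X q) (Z q)) p (Y p)
    - mvfderiv I (fun q ↦ inner ℝ (X q) (Y q)) p (Z p)
    + inner ℝ (mlieBracket I X Y p) (Z p)
    - inner ℝ (mlieBracket I X Z p) (Y p)
    - inner ℝ (mlieBracket I Y Z p) (X p)

/-- The Levi-Civita connection of `M`: `∇_X Y` at `p` is the tangent vector determined by the
Koszul formula `2 g(∇_X Y, Z) = koszul X Y Z`. It is written out in an orthonormal basis `e_i` of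
the tangent space at `p`, as `∑ i, g(∇_X Y, e_i) e_i`; to evaluate the formula, `e_i` is extended
to a vector field smooth near `p` (the value at `p` does not depend on the extension). -/
def leviCivita (X Y : Π p : M, TangentSpace I p) (p : M) : TangentSpace I p :=
  ∑ i, (koszul I X Y (FiberBundle.extend E (stdOrthonormalBasis ℝ (TangentSpace I p) i)) p / 2) •
    stdOrthonormalBasis ℝ (TangentSpace I p) i

/-- `(M, J, g)` is a Hermitian manifold: `J` is a smooth integrable almost complex structure
(its Nijenhuis tensor vanishes) and `g` is `J`-invariant. -/
structure IsHermitian (J : Π p : M, TangentSpace I p →L[ℝ] TangentSpace I p) : Prop where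
  smooth : IsSmoothEndo I J
  sq : ∀ (p : M) (v : TangentSpace I p), J p (J p v) = -v
  isometry : ∀ (p : M) (v w : TangentSpace I p), inner ℝ (J p v) (J p w) = inner ℝ v w
  integrable : ∀ X Y : Π p : M, TangentSpace I p, IsSmoothField I X → IsSmoothField I Y →
    ∀ p, nijenhuis I J X Y p = 0

/-- The Kähler form `Ω(X, Y) = g(X, JY)`. -/
def kaehlerForm (J : Π p : M, TangentSpace I p →L[ℝ] TangentSpace I p) (p : M)
    (v w : TangentSpace I p) : ℝ :=
  inner ℝ v (J p w)

/-- `η` is a Lee form of `(M, J, g)`: a smooth closed `1`-form with `dΩ = η ∧ Ω`. -/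
structure IsLeeForm (J : Π p : M, TangentSpace I p →L[ℝ] TangentSpace I p)
    (η : Π p : M, TangentSpace I p →L[ℝ] ℝ) : Prop where
  smooth : IsSmoothOneForm I η
  closed : ∀ X Y : Π p : M, TangentSpace I p, IsSmoothField I X → IsSmoothField I Y →
    ∀ p, extDerivOne I η X Y p = 0
  dKaehler_eq : ∀ X Y Z : Π p : M, TangentSpace I p, IsSmoothField I X → IsSmoothField I Y →
    IsSmoothField I Z →
    ∀ p, extDerivTwo I (kaehlerForm I J) X Y Z p = wedgeOneTwo I η (kaehlerForm I J) X Y Z p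

/-- `(M, J, g)` is a locally conformal Kähler manifold with Lee form `η`. -/
structure IsLCK (J : Π p : M, TangentSpace I p →L[ℝ] TangentSpace I p)
    (η : Π p : M, TangentSpace I p →L[ℝ] ℝ) : Prop where
  hermitian : IsHermitian I J
  leeForm : IsLeeForm I J η

/-- The Lee vector field `B₁ = η^♯`, i.e. `g(X, B₁) = η(X)`. -/
def leeField (η : Π p : M, TangentSpace I p →L[ℝ] ℝ) (p : M) : TangentSpace I p :=
  (InnerProductSpace.toDual ℝ (TangentSpace I p)).symm (η p)

/-- The second fundamental form of (the leaves of) a distribution `D`: the component of `∇_X Y`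
orthogonal to `D`. -/
def distSecondFundamentalForm (D : Π p : M, Submodule ℝ (TangentSpace I p))
    (X Y : Π p : M, TangentSpace I p) (p : M) : TangentSpace I p :=
  (D p)ᗮ.starProjection (leviCivita I X Y p)

/-- The distribution `D` defines a totally geodesic foliation: it is integrable (closed under Lie
brackets), and the second fundamental form of its leaves vanishes. -/
structure DefinesTotallyGeodesicFoliation (D : Π p : M, Submodule ℝ (TangentSpace I p)) :
    Prop where
  involutive : ∀ X Y : Π p : M, TangentSpace I p, IsSmoothField I X → IsSmoothField I Y →
    IsSectionOf I D X → IsSectionOf I D Y → IsSectionOf I D (mlieBracket I X Y)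
  totallyGeodesic : ∀ X Y : Π p : M, TangentSpace I p, IsSmoothField I X → IsSmoothField I Y →
    IsSectionOf I D X → IsSectionOf I D Y → ∀ p, distSecondFundamentalForm I D X Y p = 0

end OneManifold

section Submersion

variable {E : Type*} [NormedAddCommGroup E] [NormedSpace ℝ E]
  {H : Type*} [TopologicalSpace H] (I : ModelWithCorners ℝ E H)
  {M : Type*} [TopologicalSpace M] [ChartedSpace H M] [IsManifold I ∞ M]
  {F : Type*} [NormedAddCommGroup F] [NormedSpace ℝ F]
  {K : Type*} [TopologicalSpace K] (I' : ModelWithCorners ℝ F K)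
  {B : Type*} [TopologicalSpace B] [ChartedSpace K B] [IsManifold I' ∞ B]

/-- The vertical distribution `ker pr_*`. -/
def vertical (pr : M → B) (p : M) : Submodule ℝ (TangentSpace I p) :=
  LinearMap.ker (mfderiv I I' pr p).toLinearMap

/-- The section `pr_* X` of the pullback bundle `pr⁻¹(TB)`. -/
def pushforward (pr : M → B) (X : Π p : M, TangentSpace I p) (p : M) : TangentSpace I' (pr p) :=
  mfderiv I I' pr p (X p)

variable [FiniteDimensional ℝ E] [RiemannianBundle (fun p : M ↦ TangentSpace I p)]

/-- The horizontal distribution `(ker pr_*)^⊥`. -/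
def horizontal (pr : M → B) (p : M) : Submodule ℝ (TangentSpace I p) :=
  (vertical I I' pr p)ᗮ

/-- The vertical part `𝒱X` of a vector field. -/
def vPart (pr : M → B) (X : Π p : M, TangentSpace I p) (p : M) : TangentSpace I p :=
  (vertical I I' pr p).starProjection (X p)

/-- The horizontal part `ℋX` of a vector field. -/
def hPart (pr : M → B) (X : Π p : M, TangentSpace I p) (p : M) : TangentSpace I p :=
  (horizontal I I' pr p).starProjection (X p)

/-- O'Neill's tensor `𝒜_X Y = ℋ∇_{ℋX} 𝒱Y + 𝒱∇_{ℋX} ℋY`. -/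
def oneillA (pr : M → B) (X Y : Π p : M, TangentSpace I p) (p : M) : TangentSpace I p :=
  hPart I I' pr (leviCivita I (hPart I I' pr X) (vPart I I' pr Y)) p
    + vPart I I' pr (leviCivita I (hPart I I' pr X) (hPart I I' pr Y)) p

variable [FiniteDimensional ℝ F] [RiemannianBundle (fun b : B ↦ TangentSpace I' b)]

/-- The pullback `∇^pr` of the Levi-Civita connection of `B` to the pullback bundle `pr⁻¹(TB)`.
If `E_a` is a local frame of `TB` near `pr p` and `s = ∑ a, s^a • (E_a ∘ pr)` near `p`, then
`∇^pr_X s = ∑ a, (X(s^a) • E_a + s^a • ∇^B_{pr_* X} E_a)` at `p`. The frame is the one given by the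
canonical trivialization of `TB` at `pr p`. -/
def pullbackConnection (pr : M → B) (X : Π p : M, TangentSpace I p)
    (s : Π p : M, TangentSpace I' (pr p)) (p : M) : TangentSpace I' (pr p) :=
  let e := trivializationAt F (TangentSpace I' : B → Type _) (pr p)
  let b := Module.finBasis ℝ F
  let c : Fin (Module.finrank ℝ F) → M → ℝ := fun a q ↦ b.coord a (e ⟨pr q, s q⟩).2
  ∑ a, (mvfderiv I (c a) p (X p) • e.localFrame b a (pr p)
    + c a p • leviCivita I' (FiberBundle.extend F (pushforward I I' pr X p)) (e.localFrame b a)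
        (pr p))

/-- The second fundamental form of the map `pr`:
`(∇pr_*)(X, Y) = ∇^pr_X (pr_* Y) - pr_* (∇_X Y)`. -/
def secondFundamentalForm (pr : M → B) (X Y : Π p : M, TangentSpace I p) (p : M) :
    TangentSpace I' (pr p) :=
  pullbackConnection I I' pr X (pushforward I I' pr Y) p
    - pushforward I I' pr (leviCivita I X Y) p

/-- `pr : M → B` is a Riemannian submersion: a smooth surjective map of maximal rank whose
differential preserves the lengths of horizontal vectors. -/
structure IsRiemannianSubmersion (pr : M → B) : Prop where
  smooth : ContMDiff I I' ∞ pr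
  surjective : Function.Surjective pr
  maximalRank : ∀ p, Function.Surjective (mfderiv I I' pr p)
  isometry : ∀ p, ∀ v ∈ horizontal I I' pr p, ‖mfderiv I I' pr p v‖ = ‖v‖

/-- `pr` is a Lagrangian Riemannian submersion: `J(ker pr_*) = (ker pr_*)^⊥`. -/
structure IsLagrangianSubmersion (J : Π p : M, TangentSpace I p →L[ℝ] TangentSpace I p)
    (pr : M → B) : Prop where
  riemannian : IsRiemannianSubmersion I I' pr
  lagrangian : ∀ p, (vertical I I' pr p).map (J p).toLinearMap = horizontal I I' pr p

end Submersion

end LagrangianSubmersion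

end

/-! Each of the three conditions is a statement about g(∇_X Y, V) with X, Y horizontal and V
vertical. Since JY is vertical, 𝒜_X JY = ℋ∇_X JY, while π_*JY = 0 gives (∇π_*)(X, JY) = -π_*(∇_X
JY). As JV is horizontal and π_* preserves inner products with horizontal vectors, the left sides of
(b) and (c) are ±g(∇_X JY, JV). To compare this with g(∇_X Y, V), the Koszul formula and N = 0 give
2g(∇_X JY, JZ) - 2g(∇_X Y, Z) = -dΩ(X, Y, JZ) - dΩ(X, JY, Z) (`IsHermitian.koszul_endo`).
Substituting dΩ = ω ∧ Ω leaves exactly the Lee form terms of (b), so (b) and (c) both say g(∇_X Y,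
V) = 0. By `definesTotallyGeodesicFoliation_horizontal_iff` this is (a): vertical vectors extend to
global vertical fields, and integrability follows because ∇ is torsion free. -/

namespace LagrangianSubmersion

/-! ### The Levi-Civita connection from the Koszul formula -/

section Koszul

variable {E : Type*} [NormedAddCommGroup E] [NormedSpace ℝ E]
  {H : Type*} [TopologicalSpace H] {I : ModelWithCorners ℝ E H}
  {M : Type*} [TopologicalSpace M] [ChartedSpace H M] [IsManifold I ∞ M]

lemma IsSmoothField.mdifferentiableAt {X : Π p : M, TangentSpace I p} (hX : IsSmoothField I X)
    (p : M) : MDifferentiableAt I I.tangent (fun q ↦ (⟨q, X q⟩ : TangentBundle I M)) p :=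
  ContMDiff.mdifferentiableAt hX (by simp)

lemma IsSmoothField.endo {J : Π p : M, TangentSpace I p →L[ℝ] TangentSpace I p}
    {X : Π p : M, TangentSpace I p} (hX : IsSmoothField I X) (hJ : IsSmoothEndo I J) :
    IsSmoothField I (fun q ↦ J q (X q)) :=
  ContMDiff.clm_bundle_apply hJ hX

variable [RiemannianBundle (fun p : M ↦ TangentSpace I p)]

lemma mdifferentiableAt_inner [IsContMDiffRiemannianBundle I ∞ E (fun p : M ↦ TangentSpace I p)]
    {X Y : Π p : M, TangentSpace I p} {p : M}
    (hX : MDifferentiableAt I I.tangent (fun q ↦ (⟨q, X q⟩ : TangentBundle I M)) p)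
    (hY : MDifferentiableAt I I.tangent (fun q ↦ (⟨q, Y q⟩ : TangentBundle I M)) p) :
    MDifferentiableAt I 𝓘(ℝ) (fun q ↦ inner ℝ (X q) (Y q)) p :=
  MDifferentiableAt.inner_bundle (E := fun p : M ↦ TangentSpace I p) (F := E) (IB := I) (IM := I)
    (b := fun q ↦ q) hX hY

variable [FiniteDimensional ℝ E]

/-- The Koszul expression is tensorial in its last argument. -/
lemma tensorialAt_koszul [IsContMDiffRiemannianBundle I ∞ E (fun p : M ↦ TangentSpace I p)]
    {X Y : Π p : M, TangentSpace I p} {p : M}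
    (hX : MDifferentiableAt I I.tangent (fun q ↦ (⟨q, X q⟩ : TangentBundle I M)) p)
    (hY : MDifferentiableAt I I.tangent (fun q ↦ (⟨q, Y q⟩ : TangentBundle I M)) p) :
    TensorialAt I E (fun Z : Π p : M, TangentSpace I p ↦ koszul I X Y Z p) p where
  smul {f Z} hf hZ := by
    have hXZ := mdifferentiableAt_inner hX hZ
    have hYZ := mdifferentiableAt_inner hY hZ
    have e1 : (fun q ↦ inner ℝ (Y q) ((f • Z) q)) = fun q ↦ f q * inner ℝ (Y q) (Z q) := by
      ext q; simp [inner_smul_right]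
    have e2 : (fun q ↦ inner ℝ (X q) ((f • Z) q)) = fun q ↦ f q * inner ℝ (X q) (Z q) := by
      ext q; simp [inner_smul_right]
    -- The terms X(f)g(Y, Z) and Y(f)g(X, Z) cancel against those coming from [X, fZ] and [Y, fZ].
    simp only [koszul, e1, e2, mvfderiv_fun_mul hf hXZ, mvfderiv_fun_mul hf hYZ,
      mlieBracket_smul_right hf hZ]
    simp [inner_smul_right, inner_smul_left, inner_add_left, real_inner_comm]
    ring
  add {Z Z'} hZ hZ' := by
    have hXZ := mdifferentiableAt_inner hX hZ
    have hYZ := mdifferentiableAt_inner hY hZ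
    have hXZ' := mdifferentiableAt_inner hX hZ'
    have hYZ' := mdifferentiableAt_inner hY hZ'
    simp only [koszul, Pi.add_apply, inner_add_right, mvfderiv_fun_add hXZ hXZ',
      mvfderiv_fun_add hYZ hYZ', mlieBracket_add_right hZ hZ']
    simp [inner_add_left]
    ring

/-- The Koszul formula characterizes the Levi-Civita connection. -/
lemma inner_leviCivita [IsContMDiffRiemannianBundle I ∞ E (fun p : M ↦ TangentSpace I p)]
    {X Y Z : Π p : M, TangentSpace I p} {p : M}
    (hX : MDifferentiableAt I I.tangent (fun q ↦ (⟨q, X q⟩ : TangentBundle I M)) p)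
    (hY : MDifferentiableAt I I.tangent (fun q ↦ (⟨q, Y q⟩ : TangentBundle I M)) p)
    (hZ : MDifferentiableAt I I.tangent (fun q ↦ (⟨q, Z q⟩ : TangentBundle I M)) p) :
    inner ℝ (leviCivita I X Y p) (Z p) = koszul I X Y Z p / 2 := by
  have hT := tensorialAt_koszul hX hY
  -- By tensoriality the Koszul expression is a linear functional of Z p, so `leviCivita` is half
  -- its Riesz representative, expanded in an orthonormal basis.
  have h1 (v : TangentSpace I p) :
      koszul I X Y (FiberBundle.extend E v) p = TensorialAt.mkHom _ p hT v := rfl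
  rw [← hT.mkHom_apply hZ]
  simp only [leviCivita, h1]
  generalize TensorialAt.mkHom _ p hT = L
  generalize Z p = z
  let b := stdOrthonormalBasis ℝ (TangentSpace I p)
  have h2 : L z = ∑ i, inner ℝ (b i) z * L (b i) := by
    conv_lhs => rw [← b.sum_repr' z]
    simp [map_sum]
  rw [h2, sum_inner, Finset.sum_div]
  refine Finset.sum_congr rfl fun i _ ↦ ?_
  simp [inner_smul_left, b]
  ring

/-- The Levi-Civita connection is torsion free. -/
lemma leviCivita_sub_leviCivita (X Y : Π p : M, TangentSpace I p) (p : M) :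
    leviCivita I X Y p - leviCivita I Y X p = mlieBracket I X Y p := by
  -- Coefficients are compared: antisymmetrizing the Koszul expression in X and Y leaves 2g([X, Y],
  -- Z), an algebraic identity that needs no differentiability.
  rw [← (stdOrthonormalBasis ℝ (TangentSpace I p)).sum_repr' (mlieBracket I X Y p)]
  simp only [leviCivita, ← Finset.sum_sub_distrib, ← sub_smul]
  refine Finset.sum_congr rfl fun i _ ↦ ?_
  congr 1
  simp only [koszul, FiberBundle.extend_apply_self]
  rw [mlieBracket_swap_apply (V := Y) (W := X), inner_neg_left,
    real_inner_comm (mlieBracket I X Y p)]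
  simp only [real_inner_comm]
  ring

/-- This removes the term 𝒱∇_X ℋU of 𝒜_X U when U is vertical. -/
lemma leviCivita_zero_right (X : Π p : M, TangentSpace I p) (p : M) :
    leviCivita I X (fun _ ↦ 0) p = 0 := by
  have h : mlieBracket I X (fun _ ↦ 0) = 0 := mlieBracket_zero_right
  have h' (Z : Π p : M, TangentSpace I p) : mlieBracket I (fun _ ↦ 0) Z = 0 :=
    mlieBracket_zero_left
  simp [leviCivita, koszul, h, h', mvfderiv_const]

end Koszul

/-! ### Extending vertical vectors to global vertical fields -/

section VerticalExtension

/-- A smooth family of linear maps, checked on each vector. -/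
lemma contMDiffOn_clm_of_apply
    {E : Type*} [NormedAddCommGroup E] [NormedSpace ℝ E] [FiniteDimensional ℝ E]
    {F : Type*} [NormedAddCommGroup F] [NormedSpace ℝ F]
    {E' : Type*} [NormedAddCommGroup E'] [NormedSpace ℝ E']
    {H : Type*} [TopologicalSpace H] {I : ModelWithCorners ℝ E' H}
    {M : Type*} [TopologicalSpace M] [ChartedSpace H M] {s : Set M} {L : M → E →L[ℝ] F}
    (h : ∀ z, ContMDiffOn I 𝓘(ℝ, F) ∞ (fun q ↦ L q z) s) :
    ContMDiffOn I 𝓘(ℝ, E →L[ℝ] F) ∞ L s := by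
  let b := Module.finBasis ℝ E
  have hL : L = fun q ↦ ∑ i, ContinuousLinearMap.smulRightL ℝ E F
      (LinearMap.toContinuousLinearMap (b.coord i)) (L q (b i)) := by
    ext q z
    conv_lhs => rw [← b.sum_repr z]
    rw [map_sum]
    simp
  rw [hL]
  exact contMDiffOn_finsetSum fun i _ ↦ ContMDiffOn.clm_apply contMDiffOn_const (h (b i))

variable {E : Type*} [NormedAddCommGroup E] [NormedSpace ℝ E] [FiniteDimensional ℝ E]
  {M : Type*} [TopologicalSpace M] [T2Space M] [ChartedSpace E M] [IsManifold 𝓘(ℝ, E) ∞ M]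
  {F : Type*} [NormedAddCommGroup F] [NormedSpace ℝ F] [FiniteDimensional ℝ F]
  {B : Type*} [TopologicalSpace B] [ChartedSpace F B] [IsManifold 𝓘(ℝ, F) ∞ B]

/-- Where the differential of a map is surjective, each vector in its kernel extends to a global
smooth vector field in the kernel. -/
lemma exists_isSmoothField_vertical {pr : M → B}
    (hpr : ContMDiff 𝓘(ℝ, E) 𝓘(ℝ, F) ∞ pr) {p : M}
    (hp : Function.Surjective (mfderiv 𝓘(ℝ, E) 𝓘(ℝ, F) pr p)) {v : TangentSpace 𝓘(ℝ, E) p}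
    (hv : v ∈ vertical 𝓘(ℝ, E) 𝓘(ℝ, F) pr p) :
    ∃ V : Π q : M, TangentSpace 𝓘(ℝ, E) q, IsSmoothField 𝓘(ℝ, E) V ∧
      IsSectionOf 𝓘(ℝ, E) (vertical 𝓘(ℝ, E) 𝓘(ℝ, F) pr) V ∧ V p = v := by
  let e := trivializationAt E (TangentSpace 𝓘(ℝ, E) : M → Type _) p
  let e' := trivializationAt F (TangentSpace 𝓘(ℝ, F) : B → Type _) (pr p)
  let s : Set M := e.baseSet ∩ pr ⁻¹' e'.baseSet
  have hs : IsOpen s := e.open_baseSet.inter (e'.open_baseSet.preimage hpr.continuous)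
  have hpe : p ∈ e.baseSet := FiberBundle.mem_baseSet_trivializationAt' p
  have hpe' : pr p ∈ e'.baseSet := FiberBundle.mem_baseSet_trivializationAt' (pr p)
  have hps : p ∈ s := ⟨hpe, hpe'⟩
  -- the differential of `pr`, read in the trivializations
  let L : M → E →L[ℝ] F := fun q ↦
    (e'.continuousLinearMapAt ℝ (pr q)) ∘L (mfderiv 𝓘(ℝ, E) 𝓘(ℝ, F) pr q) ∘L (e.symmL ℝ q)
  have hLs : ContMDiffOn 𝓘(ℝ, E) 𝓘(ℝ, E →L[ℝ] F) ∞ L s := by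
    refine contMDiffOn_clm_of_apply fun z ↦ ?_
    have h1 : ContMDiffOn 𝓘(ℝ, E) 𝓘(ℝ, E).tangent ∞
        (fun q ↦ (⟨q, e.symmL ℝ q z⟩ : TangentBundle 𝓘(ℝ, E) M)) s := by
      refine (e.contMDiffOn_section_iff hs Set.inter_subset_left).2 ?_
      exact (contMDiffOn_const (c := z)).congr fun q hq ↦ by
        rw [← e.continuousLinearMapAt_apply_of_mem (R := ℝ) hq.1,
          e.continuousLinearMapAt_symmL hq.1]
    have h2 := (hpr.contMDiff_tangentMap (m := ∞) le_rfl).comp_contMDiffOn h1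
    refine ((e'.contMDiffOn_iff fun q hq ↦ e'.mem_source.2 hq.2).1 h2).2.congr fun q hq ↦ ?_
    exact e'.continuousLinearMapAt_apply_of_mem (R := ℝ) hq.2 _
  have hL0 : Function.Surjective (L p) := fun z ↦ by
    obtain ⟨y, hy⟩ := hp (e'.symmL ℝ (pr p) z)
    refine ⟨e.continuousLinearMapAt ℝ p y, ?_⟩
    simp only [L, ContinuousLinearMap.comp_apply, e.symmL_continuousLinearMapAt hpe, hy,
      e'.continuousLinearMapAt_symmL hpe']
  obtain ⟨R, hR⟩ : ∃ R : F →L[ℝ] E, L p ∘L R = ContinuousLinearMap.id ℝ F := by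
    obtain ⟨R, hR⟩ := (L p).toLinearMap.exists_rightInverse_of_surjective
      (LinearMap.range_eq_top.2 hL0)
    refine ⟨LinearMap.toContinuousLinearMap R, ?_⟩
    ext z
    exact LinearMap.congr_fun hR z
  have hLR : ContMDiffOn 𝓘(ℝ, E) 𝓘(ℝ, F →L[ℝ] F) ∞ (fun q ↦ L q ∘L R) s :=
    hLs.clm_comp contMDiffOn_const
  -- The right inverse R of L p need not invert L q, but L q ∘ R stays invertible for q near p.
  let u : Set M := s ∩ (fun q ↦ L q ∘L R) ⁻¹'
    (Set.range ((↑) : (F ≃L[ℝ] F) → F →L[ℝ] F))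
  have hu : IsOpen u := hLR.continuousOn.isOpen_inter_preimage hs ContinuousLinearEquiv.isOpen
  have hpu : p ∈ u := ⟨hps, ContinuousLinearEquiv.refl ℝ F, by simp [hR]⟩
  let w : E := e.continuousLinearMapAt ℝ p v
  -- This is the projection of the constant vector w onto ker L q along the range of R; it fixes w
  -- at p, where L p w = 0.
  let c : M → E := fun q ↦ w - R ((L q ∘L R).inverse (L q w))
  have hc : ContMDiffOn 𝓘(ℝ, E) 𝓘(ℝ, E) ∞ c u := by
    have hLw : ContMDiffOn 𝓘(ℝ, E) 𝓘(ℝ, F) ∞ (fun q ↦ L q w) u :=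
      (hLs.mono Set.inter_subset_left).clm_apply contMDiffOn_const
    have hinv : ContMDiffOn 𝓘(ℝ, E) 𝓘(ℝ, F →L[ℝ] F) ∞ (fun q ↦ (L q ∘L R).inverse) u := by
      rintro q ⟨hqs, hq⟩
      exact (ContinuousLinearMap.IsInvertible.contDiffAt_map_inverse hq).comp_contMDiffWithinAt
        (f := fun q ↦ L q ∘L R) ((hLR q hqs).mono Set.inter_subset_left)
    exact contMDiffOn_const.sub (contMDiffOn_const.clm_apply (hinv.clm_apply hLw))
  have hLc : ∀ q ∈ u, L q (c q) = 0 := by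
    rintro q ⟨-, T, hT⟩
    have h : (L q ∘L R) ((L q ∘L R).inverse (L q w)) = L q w := by
      rw [show L q ∘L R = T from hT.symm]
      simp
    simp only [c, map_sub]
    exact sub_eq_zero.2 h.symm
  have hcp : c p = w := by
    have h : L p w = 0 := by
      simp only [L, w, ContinuousLinearMap.comp_apply, e.symmL_continuousLinearMapAt hpe]
      rw [show mfderiv 𝓘(ℝ, E) 𝓘(ℝ, F) pr p v = 0 from hv, map_zero]
    simp [c, h]
  let V₀ : Π q : M, TangentSpace 𝓘(ℝ, E) q := fun q ↦ e.symmL ℝ q (c q)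
  have hV₀ : ContMDiffOn 𝓘(ℝ, E) 𝓘(ℝ, E).tangent ∞
      (fun q ↦ (⟨q, V₀ q⟩ : TangentBundle 𝓘(ℝ, E) M)) u := by
    refine (e.contMDiffOn_section_iff hu fun q hq ↦ hq.1.1).2 (hc.congr fun q hq ↦ ?_)
    rw [← e.continuousLinearMapAt_apply_of_mem (R := ℝ) hq.1.1,
      e.continuousLinearMapAt_symmL hq.1.1]
  have hV₀v : ∀ q ∈ u, mfderiv 𝓘(ℝ, E) 𝓘(ℝ, F) pr q (V₀ q) = 0 := fun q hq ↦ by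
    have h := congrArg (e'.symmL ℝ (pr q)) (hLc q hq)
    rwa [map_zero, ContinuousLinearMap.comp_apply, e'.symmL_continuousLinearMapAt hq.1.2] at h
  -- A bump function supported in u globalizes the local field; scaling keeps it vertical and ψ p =
  -- 1 keeps its value at p.
  obtain ⟨ψ, -, hψ⟩ := (SmoothBumpFunction.nhds_basis_tsupport (I := 𝓘(ℝ, E)) p).mem_iff.1
    (hu.mem_nhds hpu)
  refine ⟨fun q ↦ ψ q • V₀ q, ?_, ?_, ?_⟩
  · exact ContMDiffOn.smul_section_of_tsupport ψ.contMDiff.contMDiffOn hu hψ hV₀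
  · intro q
    by_cases hq : q ∈ u
    · exact Submodule.smul_mem _ _ (hV₀v q hq)
    · have hq0 : ψ q = 0 := image_eq_zero_of_notMem_tsupport fun h ↦ hq (hψ h)
      simp [hq0]
  · simp only [V₀, hcp, w, e.symmL_continuousLinearMapAt hpe, ψ.eq_one, one_smul]

end VerticalExtension

/-! ### Hermitian and locally conformal Kähler identities -/

section Hermitian

variable {E : Type*} [NormedAddCommGroup E] [NormedSpace ℝ E]
  {H : Type*} [TopologicalSpace H] {I : ModelWithCorners ℝ E H}
  {M : Type*} [TopologicalSpace M] [ChartedSpace H M]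
  [RiemannianBundle (fun p : M ↦ TangentSpace I p)]
  {J : Π p : M, TangentSpace I p →L[ℝ] TangentSpace I p}

lemma inner_leeField [FiniteDimensional ℝ E]
    (η : Π p : M, TangentSpace I p →L[ℝ] ℝ) (p : M) (v : TangentSpace I p) :
    inner ℝ v (leeField I η p) = η p v := by
  rw [real_inner_comm, leeField, InnerProductSpace.toDual_symm_apply]

variable [IsManifold I ∞ M]

lemma IsHermitian.inner_left (hJ : IsHermitian I J) (p : M) (v w : TangentSpace I p) :
    inner ℝ (J p v) w = -inner ℝ v (J p w) := by
  rw [← hJ.isometry p v (J p w), hJ.sq, inner_neg_right, neg_neg]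

/-- On a Hermitian manifold, `2 g(∇_X JY, JZ) - 2 g(∇_X Y, Z)` is given by the exterior derivative
of the Kähler form. -/
lemma IsHermitian.koszul_endo (hJ : IsHermitian I J) {X Y Z : Π p : M, TangentSpace I p}
    (hY : IsSmoothField I Y) (hZ : IsSmoothField I Z) (p : M) :
    koszul I X (fun q ↦ J q (Y q)) (fun q ↦ J q (Z q)) p = koszul I X Y Z p
      - extDerivTwo I (kaehlerForm I J) X Y (fun q ↦ J q (Z q)) p
      - extDerivTwo I (kaehlerForm I J) X (fun q ↦ J q (Y q)) Z p := by
  -- When all terms are moved to the left, the brackets among Y, Z, JY, JZ add up to -g(N(Y, Z), X);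
  -- everything else cancels by J-invariance of g.
  have hN := congrArg (fun v ↦ inner ℝ v (X p)) (hJ.integrable Y Z hY hZ p)
  have hneg (f : M → ℝ) : mvfderiv I (fun q ↦ -f q) p = -mvfderiv I f p := mvfderiv_fun_neg
  have hs1 := mlieBracket_swap_apply (I := I) (V := fun q ↦ J q (Z q)) (W := X) (x := p)
  have hs2 := mlieBracket_swap_apply (I := I) (V := Z) (W := X) (x := p)
  have hc1 (q : M) : inner ℝ (Z q) (J q (X q)) = -inner ℝ (X q) (J q (Z q)) := by
    rw [real_inner_comm, hJ.inner_left]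
  simp only [nijenhuis, inner_sub_left, hJ.inner_left, inner_zero_left] at hN
  simp only [koszul, extDerivTwo, kaehlerForm, hJ.sq, hJ.isometry, inner_neg_right, hneg, hs1, hs2,
    hc1, inner_neg_left]
  simp only [real_inner_comm] at hN ⊢
  simp
  linarith

variable [FiniteDimensional ℝ E]

/-- On a locally conformal Kähler manifold, the covariant derivative of `J` is given by the wedge
product of the Lee form and the Kähler form. -/
lemma IsLCK.inner_leviCivita_endo
    [IsContMDiffRiemannianBundle I ∞ E (fun p : M ↦ TangentSpace I p)]
    {η : Π p : M, TangentSpace I p →L[ℝ] ℝ} (hM : IsLCK I J η) {X Y Z : Π p : M, TangentSpace I p}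
    (hX : IsSmoothField I X) (hY : IsSmoothField I Y) (hZ : IsSmoothField I Z) (p : M) :
    inner ℝ (leviCivita I X (fun q ↦ J q (Y q)) p) (J p (Z p)) =
      inner ℝ (leviCivita I X Y p) (Z p)
        - (wedgeOneTwo I η (kaehlerForm I J) X Y (fun q ↦ J q (Z q)) p
          + wedgeOneTwo I η (kaehlerForm I J) X (fun q ↦ J q (Y q)) Z p) / 2 := by
  have hJY := hY.endo hM.hermitian.smooth
  have hJZ := hZ.endo hM.hermitian.smooth
  rw [inner_leviCivita (Z := fun q ↦ J q (Z q)) (hX.mdifferentiableAt p) (hJY.mdifferentiableAt p)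
      (hJZ.mdifferentiableAt p),
    inner_leviCivita (hX.mdifferentiableAt p) (hY.mdifferentiableAt p) (hZ.mdifferentiableAt p),
    hM.hermitian.koszul_endo hY hZ, hM.leeForm.dKaehler_eq X Y _ hX hY hJZ,
    hM.leeForm.dKaehler_eq X _ Z hX hJY hZ]
  ring

end Hermitian

/-! ### Lagrangian Riemannian submersions -/

section Submersion

variable {E : Type*} [NormedAddCommGroup E] [NormedSpace ℝ E]
  {H : Type*} [TopologicalSpace H] {I : ModelWithCorners ℝ E H}
  {M : Type*} [TopologicalSpace M] [ChartedSpace H M]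
  {F : Type*} [NormedAddCommGroup F] [NormedSpace ℝ F]
  {K : Type*} [TopologicalSpace K] {I' : ModelWithCorners ℝ F K}
  {B : Type*} [TopologicalSpace B] [ChartedSpace K B]
  {pr : M → B}

lemma pushforward_eq_zero {X : Π p : M, TangentSpace I p}
    (hX : IsSectionOf I (vertical I I' pr) X) : pushforward I I' pr X = fun _ ↦ 0 :=
  funext fun p ↦ hX p

lemma pullbackConnection_zero [IsManifold I' ∞ B] [FiniteDimensional ℝ F]
    [RiemannianBundle (fun b : B ↦ TangentSpace I' b)]
    (hpr : Continuous pr) (X : Π p : M, TangentSpace I p) (p : M) :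
    pullbackConnection I I' pr X (fun _ ↦ 0) p = 0 := by
  let e := trivializationAt F (TangentSpace I' : B → Type _) (pr p)
  let b := Module.finBasis ℝ F
  have hp : pr p ∈ e.baseSet := FiberBundle.mem_baseSet_trivializationAt' (pr p)
  -- The trivialization is known to be fibrewise linear only over its base set, so the coefficients
  -- are shown to vanish only near p, which suffices for the derivative.
  have hev (a) : (fun q ↦ b.coord a (e ⟨pr q, 0⟩).2) =ᶠ[nhds p] fun _ ↦ (0 : ℝ) := by
    filter_upwards [hpr.continuousAt.preimage_mem_nhds (e.open_baseSet.mem_nhds hp)] with q hq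
    rw [← e.continuousLinearMapAt_apply_of_mem (R := ℝ) hq, map_zero, map_zero]
  refine Finset.sum_eq_zero fun a _ ↦ ?_
  have h1 : mvfderiv I (fun q ↦ b.coord a (e ⟨pr q, 0⟩).2) p = 0 := by
    rw [mvfderiv, (hev a).mfderiv_eq, mfderiv_const]
    exact ContinuousLinearMap.comp_zero _
  have h2 : b.coord a (e ⟨pr p, 0⟩).2 = 0 := (hev a).self_of_nhds
  change mvfderiv I (fun q ↦ b.coord a (e ⟨pr q, 0⟩).2) p (X p) • _
    + b.coord a (e ⟨pr p, 0⟩).2 • _ = _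
  rw [h1, h2]
  simp

section HorizontalVertical

variable [FiniteDimensional ℝ E] [RiemannianBundle (fun p : M ↦ TangentSpace I p)]

lemma hPart_eq_self {X : Π p : M, TangentSpace I p}
    (hX : IsSectionOf I (horizontal I I' pr) X) : hPart I I' pr X = X :=
  funext fun p ↦ Submodule.starProjection_eq_self_iff.2 (hX p)

lemma vPart_eq_self {X : Π p : M, TangentSpace I p}
    (hX : IsSectionOf I (vertical I I' pr) X) : vPart I I' pr X = X :=
  funext fun p ↦ Submodule.starProjection_eq_self_iff.2 (hX p)

lemma hPart_eq_zero {X : Π p : M, TangentSpace I p}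
    (hX : IsSectionOf I (vertical I I' pr) X) : hPart I I' pr X = fun _ ↦ 0 :=
  funext fun p ↦ (Submodule.starProjection_apply_eq_zero_iff _).2
    (Submodule.le_orthogonal_orthogonal _ (hX p))

/-- For `X` horizontal and `U` vertical, `𝒜_X U = ℋ∇_X U`. -/
lemma oneillA_horizontal_vertical [IsManifold I ∞ M]
    {X U : Π p : M, TangentSpace I p}
    (hX : IsSectionOf I (horizontal I I' pr) X) (hU : IsSectionOf I (vertical I I' pr) U) :
    oneillA I I' pr X U = hPart I I' pr (leviCivita I X U) := by
  have h : leviCivita I X (fun _ ↦ 0) = 0 := funext fun p ↦ leviCivita_zero_right X p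
  ext p
  rw [oneillA, hPart_eq_self hX, vPart_eq_self hU, hPart_eq_zero hU, h]
  simp [vPart]

end HorizontalVertical

variable [RiemannianBundle (fun p : M ↦ TangentSpace I p)]
  [RiemannianBundle (fun b : B ↦ TangentSpace I' b)]
  {J : Π p : M, TangentSpace I p →L[ℝ] TangentSpace I p}

lemma IsLagrangianSubmersion.map_vertical (hpr : IsLagrangianSubmersion I I' J pr) {p : M}
    {v : TangentSpace I p} (hv : v ∈ vertical I I' pr p) : J p v ∈ horizontal I I' pr p :=
  hpr.lagrangian p ▸ Submodule.mem_map_of_mem hv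

lemma IsLagrangianSubmersion.map_horizontal [IsManifold I ∞ M]
    (hpr : IsLagrangianSubmersion I I' J pr) (hJ : IsHermitian I J)
    {p : M} {v : TangentSpace I p} (hv : v ∈ horizontal I I' pr p) :
    J p v ∈ vertical I I' pr p := by
  rw [← hpr.lagrangian p] at hv
  obtain ⟨u, hu, rfl⟩ := hv
  exact (hJ.sq p u).symm ▸ Submodule.neg_mem _ hu

variable [FiniteDimensional ℝ E]

/-- A Riemannian submersion preserves inner products with horizontal vectors. -/
lemma IsRiemannianSubmersion.inner_mfderiv (hpr : IsRiemannianSubmersion I I' pr) {p : M}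
    (w : TangentSpace I p) {h : TangentSpace I p} (hh : h ∈ horizontal I I' pr p) :
    inner ℝ (mfderiv I I' pr p w) (mfderiv I I' pr p h) = inner ℝ w h := by
  -- Only the horizontal part of w contributes; on horizontal vectors, preservation of norms
  -- polarizes to preservation of inner products.
  obtain ⟨v, hv, k, hk, rfl⟩ := (vertical I I' pr p).exists_add_mem_mem_orthogonal w
  have hv' : mfderiv I I' pr p v = 0 := hv
  rw [inner_add_left, hh v hv, zero_add, map_add, hv', zero_add,
    real_inner_eq_norm_add_mul_self_sub_norm_mul_self_sub_norm_mul_self_div_two,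
    real_inner_eq_norm_add_mul_self_sub_norm_mul_self_sub_norm_mul_self_div_two,
    ← map_add, hpr.isometry p _ hk, hpr.isometry p _ hh,
    hpr.isometry p _ (Submodule.add_mem _ hk hh)]

variable [IsManifold I ∞ M]

variable {η : Π p : M, TangentSpace I p →L[ℝ] ℝ}
  {X Y V : Π p : M, TangentSpace I p}

/-- For `X`, `Y` horizontal and `V` vertical, `g(∇_X JY, JV)` differs from `g(∇_X Y, V)` by terms
in the Lee form. -/
lemma IsLagrangianSubmersion.inner_leviCivita_endo
    [IsContMDiffRiemannianBundle I ∞ E (fun p : M ↦ TangentSpace I p)]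
    (hpr : IsLagrangianSubmersion I I' J pr) (hM : IsLCK I J η)
    (hX : IsSmoothField I X) (hY : IsSmoothField I Y) (hV : IsSmoothField I V)
    (hXs : IsSectionOf I (horizontal I I' pr) X) (hYs : IsSectionOf I (horizontal I I' pr) Y)
    (hVs : IsSectionOf I (vertical I I' pr) V) (p : M) :
    inner ℝ (leviCivita I X (fun q ↦ J q (Y q)) p) (J p (V p)) =
      inner ℝ (leviCivita I X Y p) (V p)
        + (1 / 2 * inner ℝ (J p (Y p)) (leeField I η p) * inner ℝ (X p) (J p (V p))
          + 1 / 2 * inner ℝ (X p) (Y p) * inner ℝ (leeField I η p) (V p)) := by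
  have hJ := hM.hermitian
  have hYV : inner ℝ (Y p) (V p) = 0 := by rw [real_inner_comm]; exact hYs p _ (hVs p)
  have hXJY : inner ℝ (X p) (J p (Y p)) = 0 := by
    rw [real_inner_comm]; exact hXs p _ (hpr.map_horizontal hJ (hYs p))
  have hVX : inner ℝ (V p) (X p) = 0 := hXs p _ (hVs p)
  have hVJX : inner ℝ (V p) (J p (X p)) = -inner ℝ (X p) (J p (V p)) := by
    rw [real_inner_comm, hJ.inner_left]
  rw [hM.inner_leviCivita_endo hX hY hV, real_inner_comm (V p) (leeField I η p), inner_leeField,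
    inner_leeField]
  -- All of (ω ∧ Ω)(X, Y, JV) vanishes, and (ω ∧ Ω)(X, JY, V) reduces to -ω(JY)g(X, JV) - ω(V)g(X,
  -- Y).
  simp only [wedgeOneTwo, kaehlerForm, hJ.sq, hJ.isometry, inner_neg_right, hYV, hXJY, hVX, hVJX]
  ring

/-- For `X`, `Y` horizontal and `V` vertical, `g_B(pr_* 𝒜_X JY, pr_* JV) = g(∇_X JY, JV)`. -/
lemma IsLagrangianSubmersion.inner_pushforward_oneillA
    (hpr : IsLagrangianSubmersion I I' J pr) (hJ : IsHermitian I J)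
    (hXs : IsSectionOf I (horizontal I I' pr) X) (hYs : IsSectionOf I (horizontal I I' pr) Y)
    (hVs : IsSectionOf I (vertical I I' pr) V) (p : M) :
    inner ℝ (pushforward I I' pr (oneillA I I' pr X (fun q ↦ J q (Y q))) p)
        (pushforward I I' pr (fun q ↦ J q (V q)) p) =
      inner ℝ (leviCivita I X (fun q ↦ J q (Y q)) p) (J p (V p)) := by
  have hJV := hpr.map_vertical (hVs p)
  rw [oneillA_horizontal_vertical hXs fun q ↦ hpr.map_horizontal hJ (hYs q), pushforward,
    pushforward, hpr.riemannian.inner_mfderiv _ hJV, hPart,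
    Submodule.inner_starProjection_left_eq_right, Submodule.starProjection_eq_self_iff.2 hJV]

variable [IsManifold I' ∞ B] [FiniteDimensional ℝ F]

/-- For `X`, `Y` horizontal and `V` vertical, `g_B((∇pr_*)(X, JY), pr_* JV) = -g(∇_X JY, JV)`. -/
lemma IsLagrangianSubmersion.inner_secondFundamentalForm
    (hpr : IsLagrangianSubmersion I I' J pr) (hJ : IsHermitian I J)
    (hYs : IsSectionOf I (horizontal I I' pr) Y)
    (hVs : IsSectionOf I (vertical I I' pr) V) (p : M) :
    inner ℝ (secondFundamentalForm I I' pr X (fun q ↦ J q (Y q)) p)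
        (pushforward I I' pr (fun q ↦ J q (V q)) p) =
      -inner ℝ (leviCivita I X (fun q ↦ J q (Y q)) p) (J p (V p)) := by
  rw [secondFundamentalForm, pushforward_eq_zero fun q ↦ hpr.map_horizontal hJ (hYs q),
    pullbackConnection_zero hpr.riemannian.smooth.continuous, zero_sub, inner_neg_left,
    pushforward, pushforward, hpr.riemannian.inner_mfderiv _ (hpr.map_vertical (hVs p))]

end Submersion

/-! ### Total geodesy of the horizontal distribution -/

section TotallyGeodesic

variable {E : Type*} [NormedAddCommGroup E] [NormedSpace ℝ E] [FiniteDimensional ℝ E]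
  {M : Type*} [TopologicalSpace M] [T2Space M] [ChartedSpace E M] [IsManifold 𝓘(ℝ, E) ∞ M]
  [RiemannianBundle (fun p : M ↦ TangentSpace 𝓘(ℝ, E) p)]
  {F : Type*} [NormedAddCommGroup F] [NormedSpace ℝ F] [FiniteDimensional ℝ F]
  {B : Type*} [TopologicalSpace B] [ChartedSpace F B] [IsManifold 𝓘(ℝ, F) ∞ B]

/-- The horizontal distribution of a submersion defines a totally geodesic foliation if and only if
`g(∇_X Y, V) = 0` for `X`, `Y` horizontal and `V` vertical. -/
lemma definesTotallyGeodesicFoliation_horizontal_iff {pr : M → B}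
    (hpr : ContMDiff 𝓘(ℝ, E) 𝓘(ℝ, F) ∞ pr)
    (hsurj : ∀ p, Function.Surjective (mfderiv 𝓘(ℝ, E) 𝓘(ℝ, F) pr p)) :
    DefinesTotallyGeodesicFoliation 𝓘(ℝ, E) (horizontal 𝓘(ℝ, E) 𝓘(ℝ, F) pr) ↔
      ∀ X Y V : Π p : M, TangentSpace 𝓘(ℝ, E) p,
        IsSmoothField 𝓘(ℝ, E) X → IsSmoothField 𝓘(ℝ, E) Y → IsSmoothField 𝓘(ℝ, E) V →
        IsSectionOf 𝓘(ℝ, E) (horizontal 𝓘(ℝ, E) 𝓘(ℝ, F) pr) X →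
        IsSectionOf 𝓘(ℝ, E) (horizontal 𝓘(ℝ, E) 𝓘(ℝ, F) pr) Y →
        IsSectionOf 𝓘(ℝ, E) (vertical 𝓘(ℝ, E) 𝓘(ℝ, F) pr) V →
        ∀ p, inner ℝ (leviCivita 𝓘(ℝ, E) X Y p) (V p) = 0 := by
  have hsff (X Y : Π p : M, TangentSpace 𝓘(ℝ, E) p) (p : M) :
      distSecondFundamentalForm 𝓘(ℝ, E) (horizontal 𝓘(ℝ, E) 𝓘(ℝ, F) pr) X Y p = 0 ↔
        leviCivita 𝓘(ℝ, E) X Y p ∈ horizontal 𝓘(ℝ, E) 𝓘(ℝ, F) pr p := by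
    rw [distSecondFundamentalForm, Submodule.starProjection_apply_eq_zero_iff,
      Submodule.orthogonal_orthogonal]
  refine ⟨fun h X Y V hX hY _ hXs hYs hVs p ↦ ?_, fun h ↦ ?_⟩
  · rw [real_inner_comm]
    exact (hsff X Y p).1 (h.totallyGeodesic X Y hX hY hXs hYs p) _ (hVs p)
  · have hmem (X Y : Π p : M, TangentSpace 𝓘(ℝ, E) p) (hX : IsSmoothField 𝓘(ℝ, E) X)
        (hY : IsSmoothField 𝓘(ℝ, E) Y)
        (hXs : IsSectionOf 𝓘(ℝ, E) (horizontal 𝓘(ℝ, E) 𝓘(ℝ, F) pr) X)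
        (hYs : IsSectionOf 𝓘(ℝ, E) (horizontal 𝓘(ℝ, E) 𝓘(ℝ, F) pr) Y) (p : M) :
        leviCivita 𝓘(ℝ, E) X Y p ∈ horizontal 𝓘(ℝ, E) 𝓘(ℝ, F) pr p := fun v hv ↦ by
      -- The hypothesis concerns global vertical fields, whereas orthogonality must be tested on
      -- every vertical vector at p.
      obtain ⟨V, hV, hVs, rfl⟩ := exists_isSmoothField_vertical hpr (hsurj p) hv
      rw [real_inner_comm]
      exact h X Y V hX hY hV hXs hYs hVs p
    refine ⟨fun X Y hX hY hXs hYs p ↦ ?_, fun X Y hX hY hXs hYs p ↦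
      (hsff X Y p).2 (hmem X Y hX hY hXs hYs p)⟩
    -- Involutivity is automatic: [X, Y] = ∇_X Y - ∇_Y X is a difference of horizontal vectors.
    rw [← leviCivita_sub_leviCivita]
    exact Submodule.sub_mem _ (hmem X Y hX hY hXs hYs p) (hmem Y X hY hX hYs hXs p)

end TotallyGeodesic

end LagrangianSubmersion

/-! ### The main equivalence -/

open LagrangianSubmersion in
theorem corollary4p2
    {E : Type*} [NormedAddCommGroup E] [NormedSpace ℝ E] [FiniteDimensional ℝ E]
    {M : Type*} [TopologicalSpace M] [T2Space M] [SecondCountableTopology M]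
    [ChartedSpace E M] [IsManifold 𝓘(ℝ, E) ∞ M]
    [RiemannianBundle (fun p : M ↦ TangentSpace 𝓘(ℝ, E) p)]
    [IsContMDiffRiemannianBundle 𝓘(ℝ, E) ∞ E (fun p : M ↦ TangentSpace 𝓘(ℝ, E) p)]
    {F : Type*} [NormedAddCommGroup F] [NormedSpace ℝ F] [FiniteDimensional ℝ F]
    {B : Type*} [TopologicalSpace B] [T2Space B] [SecondCountableTopology B]
    [ChartedSpace F B] [IsManifold 𝓘(ℝ, F) ∞ B]
    [RiemannianBundle (fun b : B ↦ TangentSpace 𝓘(ℝ, F) b)]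
    [IsContMDiffRiemannianBundle 𝓘(ℝ, F) ∞ F (fun b : B ↦ TangentSpace 𝓘(ℝ, F) b)]
    (J : Π p : M, TangentSpace 𝓘(ℝ, E) p →L[ℝ] TangentSpace 𝓘(ℝ, E) p)
    (η : Π p : M, TangentSpace 𝓘(ℝ, E) p →L[ℝ] ℝ)
    (hM : IsLCK 𝓘(ℝ, E) J η)
    (pr : M → B) (hpr : IsLagrangianSubmersion 𝓘(ℝ, E) 𝓘(ℝ, F) J pr) :
    List.TFAE [
      DefinesTotallyGeodesicFoliation 𝓘(ℝ, E) (horizontal 𝓘(ℝ, E) 𝓘(ℝ, F) pr),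
      ∀ X Y V : Π p : M, TangentSpace 𝓘(ℝ, E) p,
        IsSmoothField 𝓘(ℝ, E) X → IsSmoothField 𝓘(ℝ, E) Y → IsSmoothField 𝓘(ℝ, E) V →
        IsSectionOf 𝓘(ℝ, E) (horizontal 𝓘(ℝ, E) 𝓘(ℝ, F) pr) X →
        IsSectionOf 𝓘(ℝ, E) (horizontal 𝓘(ℝ, E) 𝓘(ℝ, F) pr) Y →
        IsSectionOf 𝓘(ℝ, E) (vertical 𝓘(ℝ, E) 𝓘(ℝ, F) pr) V →
        ∀ p,
          inner ℝ
              (pushforward 𝓘(ℝ, E) 𝓘(ℝ, F) pr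
                (oneillA 𝓘(ℝ, E) 𝓘(ℝ, F) pr X (fun q ↦ J q (Y q))) p)
              (pushforward 𝓘(ℝ, E) 𝓘(ℝ, F) pr (fun q ↦ J q (V q)) p) =
            1 / 2 * inner ℝ (J p (Y p)) (leeField 𝓘(ℝ, E) η p) * inner ℝ (X p) (J p (V p))
              + 1 / 2 * inner ℝ (X p) (Y p) * inner ℝ (leeField 𝓘(ℝ, E) η p) (V p),
      ∀ X Y V : Π p : M, TangentSpace 𝓘(ℝ, E) p,
        IsSmoothField 𝓘(ℝ, E) X → IsSmoothField 𝓘(ℝ, E) Y → IsSmoothField 𝓘(ℝ, E) V →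
        IsSectionOf 𝓘(ℝ, E) (horizontal 𝓘(ℝ, E) 𝓘(ℝ, F) pr) X →
        IsSectionOf 𝓘(ℝ, E) (horizontal 𝓘(ℝ, E) 𝓘(ℝ, F) pr) Y →
        IsSectionOf 𝓘(ℝ, E) (vertical 𝓘(ℝ, E) 𝓘(ℝ, F) pr) V →
        ∀ p,
          inner ℝ
              (secondFundamentalForm 𝓘(ℝ, E) 𝓘(ℝ, F) pr X (fun q ↦ J q (Y q)) p)
              (pushforward 𝓘(ℝ, E) 𝓘(ℝ, F) pr (fun q ↦ J q (V q)) p) =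
            -(1 / 2 * inner ℝ (J p (Y p)) (leeField 𝓘(ℝ, E) η p) * inner ℝ (X p) (J p (V p)))
              - 1 / 2 * inner ℝ (X p) (Y p) * inner ℝ (leeField 𝓘(ℝ, E) η p) (V p)] := by
  have hsub := hpr.riemannian
  rw [definesTotallyGeodesicFoliation_horizontal_iff hsub.smooth hsub.maximalRank]
  tfae_have 1 ↔ 2 := by
    -- The equivalence holds for each X, Y, V and p separately: both sides of (b) contain the same
    -- Lee form terms, which cancel.
    refine forall₃_congr fun X Y V ↦ forall₃_congr fun hX hY hV ↦
      forall₃_congr fun hXs hYs hVs ↦ forall_congr' fun p ↦ ?_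
    rw [hpr.inner_pushforward_oneillA hM.hermitian hXs hYs hVs,
      hpr.inner_leviCivita_endo hM hX hY hV hXs hYs hVs, add_eq_right]
  tfae_have 1 ↔ 3 := by
    refine forall₃_congr fun X Y V ↦ forall₃_congr fun hX hY hV ↦
      forall₃_congr fun hXs hYs hVs ↦ forall_congr' fun p ↦ ?_
    rw [hpr.inner_secondFundamentalForm hM.hermitian hYs hVs,
      hpr.inner_leviCivita_endo hM hX hY hV hXs hYs hVs, ← neg_add', neg_inj, add_eq_right]
  tfae_finish
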